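/- Let $d\ge 2$ and let $\mathcal S^1=\mathbb R/\mathbb Z$ be the circle of length $1$. Let $\xi\in C^2(\mathcal S^1;\mathbb R^d)$ and $\sigma:\mathcal S^1\to\mathbb R$ solve the stationary equation $$\partial_s(\sigma\,\partial_s\xi)+\xi=0,\qquad |\partial_s\xi|=1\qquad\text{on }\mathcal S^1$$ in the classical sense (that is, $\sigma\,\partial_s\xi$ is differentiable everywhere, with derivative $-\xi$). Assume that $\xi$ is simple, i.e. $\xi(s_1)\neq\xi(s_2)$ for $s_1\neq s_2$, and that $$\int_0^1\sigma\,ds\ \ge\ \frac{27}{32}\cdot\frac{1}{4\pi^2}.$$ Then $\sigma\equiv\frac{1}{4\pi^2}$, and $\xi$ is a circle centred at $0$ with radius $\frac1{2\pi}$: there are orthonormal vectors $e_1,e_2\in\mathbb R^d$ such that $\xi(s)=\frac1{2\pi}\bigl(\cos(2\pi s)\,e_1+\sin(2\pi s)\,e_2\bigr)$ for all $s$. -/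

import Mathlib

open Real

/-- The lift to `ℝ` of a map on the circle `ℝ / ℤ` of length `1`. -/
def circleLift {E : Type*} (f : UnitAddCircle → E) (t : ℝ) : E :=
  f (t : UnitAddCircle)

/-- `f : ℝ / ℤ → E` is of class `C²`. -/
def IsC2OnCircle {E : Type*} [NormedAddCommGroup E] [NormedSpace ℝ E]
    (f : UnitAddCircle → E) : Prop :=
  ContDiff ℝ 2 (circleLift f)

/-- The pair `(ξ, σ)` solves the stationary equation `∂ₛ(σ ∂ₛξ) + ξ = 0`, `|∂ₛξ| = 1` on `ℝ / ℤ`,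
in the classical sense: `σ ∂ₛξ` is differentiable everywhere, with derivative `-ξ`. -/
structure IsStationarySolution {E : Type*} [NormedAddCommGroup E] [NormedSpace ℝ E]
    (ξ : UnitAddCircle → E) (σ : UnitAddCircle → ℝ) : Prop where
  equation : ∀ s : ℝ,
    HasDerivAt (fun t : ℝ => circleLift σ t • deriv (circleLift ξ) t) (-circleLift ξ s) s
  unit_speed : ∀ s : ℝ, ‖deriv (circleLift ξ) s‖ = 1

/-- `ξ : ℝ / ℤ → E` is a circle with centre `c` and radius `r`, traversed once at constant speed,
in some two-dimensional plane through `c`, with either orientation. -/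
def IsRoundCircle {E : Type*} [NormedAddCommGroup E] [InnerProductSpace ℝ E]
    (ξ : UnitAddCircle → E) (c : E) (r : ℝ) : Prop :=
  ∃ e₁ e₂ : E, ‖e₁‖ = 1 ∧ ‖e₂‖ = 1 ∧ inner ℝ e₁ e₂ = 0 ∧
    ∀ t : ℝ, circleLift ξ t = c + r • (cos (2 * π * t) • e₁ + sin (2 * π * t) • e₂)

/-! Pairing the equation with the tangent `T` gives `σ' = -x` for `x = ⟪X, T⟫`, and the angular
momentum `J` is conserved. It is non-zero because a closed curve is not a line, so `σ` never
vanishes; the integral bound serves only to make `σ` positive. The curve then has curvature `J / σ ^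
2`, and `σ'' = J ^ 2 / σ ^ 3 - 1`.

By ODE uniqueness the curve is symmetric about any critical point `a` of `σ`. By periodicity `a +
1/2` is critical too, and simplicity keeps the arc between them strictly on one side of the mirror.
This makes the tangent angle `θ`, with `dθ = J / σ ^ 2 ds`, sweep exactly `[0, π]`.

The core is `exists_degenerate_of_half_turn`, a double Sturm comparison in `θ`: `x` oscillates
faster than `sin θ`, so it has a zero inside the arc, while `v = J x / σ` oscillates more slowly
than `sin 2θ`, so no zero of `x` lies within a quarter turn of an end. These conflict unless some
zero of `x` is degenerate, and then uniqueness makes `σ` constant. The curve is a circle, and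
simplicity leaves a single turn. -/

/-- A unit speed curve `X` with unit tangent `T`, unit normal `N`, tension `σ` and
`x = ⟪X, T⟫ = -σ'`, subject to the Frenet system of the stationary equation with angular
momentum `J > 0` and tension `σ > 0`. -/
structure StationaryFrame {E : Type*} [NormedAddCommGroup E] [InnerProductSpace ℝ E]
    (X T N : ℝ → E) (σ x : ℝ → ℝ) (J : ℝ) : Prop where
  J_pos : 0 < J
  tension_pos : ∀ s, 0 < σ s
  deriv_curve : ∀ s, HasDerivAt X (T s) s
  deriv_tangent : ∀ s, HasDerivAt T ((J / σ s ^ 2) • N s) s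
  deriv_normal : ∀ s, HasDerivAt N (-(J / σ s ^ 2) • T s) s
  deriv_tension : ∀ s, HasDerivAt σ (-x s) s
  deriv_radial : ∀ s, HasDerivAt x (1 - J ^ 2 / σ s ^ 3) s
  norm_tangent : ∀ s, ‖T s‖ = 1
  norm_normal : ∀ s, ‖N s‖ = 1
  orthogonal : ∀ s, inner ℝ (T s) (N s) = 0
  curve_eq : ∀ s, X s = x s • T s - (J / σ s) • N s
  periodic_curve : Function.Periodic X 1
  periodic_tension : Function.Periodic σ 1

/-! ### Conservation laws and the Frenet frame. -/

section Construction

variable {E : Type*} [NormedAddCommGroup E] [InnerProductSpace ℝ E]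
  {X T T' : ℝ → E} {σ : ℝ → ℝ}

theorem inner_deriv_eq_zero_of_unit (hT : ∀ s, HasDerivAt T (T' s) s) (h1 : ∀ s, ‖T s‖ = 1)
    (s : ℝ) : inner ℝ (T s) (T' s) = 0 := by
  have h := (hT s).inner ℝ (hT s)
  have hc : (fun t => inner ℝ (T t) (T t)) = fun _ => (1 : ℝ) := by
    funext t
    rw [real_inner_self_eq_norm_sq, h1, one_pow]
  rw [hc] at h
  have := h.unique (hasDerivAt_const s (1 : ℝ))
  rw [real_inner_comm (T s) (T' s)] at this
  linarith

theorem hasDerivAt_tension (hT : ∀ s, HasDerivAt T (T' s) s) (h1 : ∀ s, ‖T s‖ = 1)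
    (heq : ∀ s, HasDerivAt (fun t => σ t • T t) (-X s) s) (s : ℝ) :
    HasDerivAt σ (-inner ℝ (X s) (T s)) s := by
  have h := (heq s).inner ℝ (hT s)
  have hc : (fun t => inner ℝ (σ t • T t) (T t)) = σ := by
    funext t
    rw [real_inner_smul_left, real_inner_self_eq_norm_sq, h1]
    ring
  rw [hc] at h
  refine h.congr_deriv ?_
  rw [real_inner_smul_left, inner_deriv_eq_zero_of_unit hT h1, inner_neg_left]
  ring

theorem tension_smul_deriv_tangent (hT : ∀ s, HasDerivAt T (T' s) s) (h1 : ∀ s, ‖T s‖ = 1)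
    (heq : ∀ s, HasDerivAt (fun t => σ t • T t) (-X s) s) (s : ℝ) :
    σ s • T' s = -X s + (inner ℝ (X s) (T s) : ℝ) • T s := by
  have h := ((hasDerivAt_tension hT h1 heq s).smul (hT s)).unique (heq s)
  rw [← h, neg_smul]
  abel

theorem hasDerivAt_radial (hX : ∀ s, HasDerivAt X (T s) s) (hT : ∀ s, HasDerivAt T (T' s) s)
    (h1 : ∀ s, ‖T s‖ = 1) (s : ℝ) :
    HasDerivAt (fun t => (inner ℝ (X t) (T t) : ℝ)) (inner ℝ (X s) (T' s) + 1) s := by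
  have h := (hX s).inner ℝ (hT s)
  rwa [real_inner_self_eq_norm_sq, h1, one_pow] at h

theorem tension_mul_inner (hT : ∀ s, HasDerivAt T (T' s) s) (h1 : ∀ s, ‖T s‖ = 1)
    (heq : ∀ s, HasDerivAt (fun t => σ t • T t) (-X s) s) (s : ℝ) :
    σ s * inner ℝ (X s) (T' s) = inner ℝ (X s) (T s) ^ 2 - inner ℝ (X s) (X s) := by
  rw [← real_inner_smul_right, tension_smul_deriv_tangent hT h1 heq, inner_add_right,
    inner_neg_right, real_inner_smul_right]
  ring

/-- The quantity is `|X ∧ σT| ^ 2`, and `(X ∧ σT)' = T ∧ σT - X ∧ X = 0`. -/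
theorem angular_momentum_const (hX : ∀ s, HasDerivAt X (T s) s)
    (hT : ∀ s, HasDerivAt T (T' s) s) (h1 : ∀ s, ‖T s‖ = 1)
    (heq : ∀ s, HasDerivAt (fun t => σ t • T t) (-X s) s) (s t : ℝ) :
    σ s ^ 2 * (inner ℝ (X s) (X s) - inner ℝ (X s) (T s) ^ 2) =
      σ t ^ 2 * (inner ℝ (X t) (X t) - inner ℝ (X t) (T t) ^ 2) := by
  have hd : ∀ r, HasDerivAt
      (fun s => σ s ^ 2 * (inner ℝ (X s) (X s) - (inner ℝ (X s) (T s) : ℝ) ^ 2)) 0 r := by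
    intro r
    have h := ((hasDerivAt_tension hT h1 heq r).pow 2).mul
      (((hX r).inner ℝ (hX r)).sub ((hasDerivAt_radial hX hT h1 r).pow 2))
    refine h.congr_deriv ?_
    have hm := tension_mul_inner hT h1 heq r
    rw [real_inner_comm (X r) (T r)]
    simp only [Pi.pow_apply, Pi.sub_apply]
    push_cast
    linear_combination (-2 * σ r * inner ℝ (X r) (T r)) * hm
  exact is_const_of_deriv_eq_zero (fun r => (hd r).differentiableAt) (fun r => (hd r).deriv) s t

theorem normSq_neg_add_inner_smul (h1 : ∀ s, ‖T s‖ = 1) (s : ℝ) :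
    ‖-X s + (inner ℝ (X s) (T s) : ℝ) • T s‖ ^ 2 =
      inner ℝ (X s) (X s) - inner ℝ (X s) (T s) ^ 2 := by
  rw [← real_inner_self_eq_norm_sq]
  simp only [inner_add_left, inner_add_right, inner_neg_left, inner_neg_right,
    real_inner_smul_left, real_inner_smul_right, real_inner_comm (X s) (T s)]
  rw [real_inner_self_eq_norm_sq (T s), h1]
  ring

/-- A closed stationary curve has non-zero angular momentum. -/
theorem angular_momentum_pos (hX : ∀ s, HasDerivAt X (T s) s)
    (hT : ∀ s, HasDerivAt T (T' s) s) (hT' : Continuous T') (h1 : ∀ s, ‖T s‖ = 1)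
    (heq : ∀ s, HasDerivAt (fun t => σ t • T t) (-X s) s) (hper : Function.Periodic X 1) (s : ℝ) :
    0 < σ s ^ 2 * (inner ℝ (X s) (X s) - (inner ℝ (X s) (T s) : ℝ) ^ 2) := by
  have hnn : ∀ s, 0 ≤ (inner ℝ (X s) (X s) - (inner ℝ (X s) (T s) : ℝ) ^ 2) := fun s => by
    rw [← normSq_neg_add_inner_smul h1]; positivity
  refine lt_of_le_of_ne (mul_nonneg (sq_nonneg _) (hnn s)) fun h0 => ?_
  have hz : ∀ t, σ t ≠ 0 → T' t = 0 := by
    intro t ht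
    have h := angular_momentum_const hX hT h1 heq s t
    rw [← h0] at h
    have h2 := normSq_neg_add_inner_smul (X := X) h1 t
    have h3 : inner ℝ (X t) (X t) - (inner ℝ (X t) (T t) : ℝ) ^ 2 = 0 := by
      rcases mul_eq_zero.1 h.symm with h | h
      · exact absurd (pow_eq_zero_iff (two_ne_zero) |>.1 h) ht
      · exact h
    rw [h3, ← tension_smul_deriv_tangent hT h1 heq] at h2
    have h4 : σ t • T' t = 0 := norm_eq_zero.1 (pow_eq_zero_iff two_ne_zero |>.1 h2)
    exact (smul_eq_zero.1 h4).resolve_left ht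
  -- Where `T' ≠ 0`, `σ` vanishes on a neighbourhood; the equation then gives `X = 0` there, against
  -- unit speed.
  have hz' : ∀ t, T' t = 0 := by
    intro t
    by_contra ht
    have e1 : ∀ᶠ r in nhds t, σ r = 0 := by
      filter_upwards [hT'.continuousAt.eventually_ne ht] with r hr
      by_contra h
      exact hr (hz r h)
    have e2 : ∀ᶠ r in nhds t, X r = 0 := by
      filter_upwards [e1.eventually_nhds] with r hr
      have h5 : HasDerivAt (fun t => σ t • T t) 0 r := by
        refine (hasDerivAt_const r (0 : E)).congr_of_eventuallyEq ?_
        filter_upwards [hr] with q hq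
        rw [hq, zero_smul]
      exact neg_eq_zero.1 ((heq r).unique h5)
    have h6 : HasDerivAt X 0 t := (hasDerivAt_const t (0 : E)).congr_of_eventuallyEq e2
    have h7 := h1 t
    rw [(hX t).unique h6, norm_zero] at h7
    exact zero_ne_one h7
  have hTc : ∀ r, T r = T 0 := fun r => is_const_of_deriv_eq_zero
    (fun r => (hT r).differentiableAt) (fun r => (hT r).deriv.trans (hz' r)) r 0
  have hd : ∀ r, HasDerivAt (fun r => X r - r • T 0) 0 r := by
    intro r
    have := (hX r).sub ((hasDerivAt_id r).smul_const (T 0))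
    rwa [hTc r, one_smul, sub_self] at this
  have hc := is_const_of_deriv_eq_zero (fun r => (hd r).differentiableAt)
    (fun r => (hd r).deriv) 1 0
  have hp := hper 0
  rw [zero_add] at hp
  simp only [hp, one_smul, zero_smul, sub_zero] at hc
  have : T 0 = 0 := by simpa using hc
  have h7 := h1 0
  rw [this, norm_zero] at h7
  exact zero_ne_one h7

theorem exists_stationaryFrame (hX : ∀ s, HasDerivAt X (T s) s)
    (hT : ∀ s, HasDerivAt T (T' s) s) (hT' : Continuous T') (h1 : ∀ s, ‖T s‖ = 1)
    (heq : ∀ s, HasDerivAt (fun t => σ t • T t) (-X s) s) (hper : Function.Periodic X 1)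
    (hσper : Function.Periodic σ 1) (hint : 0 < ∫ s in (0 : ℝ)..1, σ s) :
    ∃ (N : ℝ → E) (x : ℝ → ℝ) (J : ℝ), StationaryFrame X T N σ x J := by
  obtain ⟨c, hc⟩ : ∃ c, c = σ 0 ^ 2 * (inner ℝ (X 0) (X 0) - (inner ℝ (X 0) (T 0) : ℝ) ^ 2) :=
    ⟨_, rfl⟩
  have hcpos : 0 < c := hc ▸ angular_momentum_pos hX hT hT' h1 heq hper 0
  have hcs : ∀ s, σ s ^ 2 * (inner ℝ (X s) (X s) - (inner ℝ (X s) (T s) : ℝ) ^ 2) = c :=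
    fun s => by rw [hc]; exact angular_momentum_const hX hT h1 heq s 0
  have hσ := hasDerivAt_tension hT h1 heq
  have hσc : Continuous σ := continuous_iff_continuousAt.2 fun s => (hσ s).continuousAt
  have hne : ∀ s, σ s ≠ 0 := fun s h => by
    have := hcs s
    rw [h] at this
    linarith
  have hpos : ∀ s, 0 < σ s := by
    by_contra! h
    obtain ⟨s, hs⟩ := h
    have hneg : ∀ t, σ t ≤ 0 := by
      by_contra! h
      obtain ⟨t, ht⟩ := h
      obtain ⟨r, hr⟩ := mem_range_of_exists_le_of_exists_ge hσc ⟨s, hs⟩ ⟨t, ht.le⟩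
      exact hne r hr
    have := intervalIntegral.integral_nonneg (μ := MeasureTheory.volume) (zero_le_one' ℝ)
      (f := fun s => -σ s) fun u _ => neg_nonneg.2 (hneg u)
    rw [intervalIntegral.integral_neg] at this
    linarith
  obtain ⟨J, hJ, hJc⟩ : ∃ J : ℝ, 0 < J ∧ J ^ 2 = c := ⟨√c, sqrt_pos.2 hcpos, sq_sqrt hcpos.le⟩
  have hx : ∀ s, HasDerivAt (fun t => (inner ℝ (X t) (T t) : ℝ)) (1 - J ^ 2 / σ s ^ 3) s := by
    intro s
    convert hasDerivAt_radial hX hT h1 s using 1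
    have h := tension_mul_inner hT h1 heq s
    have h2 := hcs s
    have := hne s
    rw [hJc]
    field_simp
    linear_combination h2 - σ s ^ 2 * h
  have hN2 : ∀ s, ‖-X s + (inner ℝ (X s) (T s) : ℝ) • T s‖ ^ 2 = (J / σ s) ^ 2 := by
    intro s
    rw [normSq_neg_add_inner_smul h1, div_pow, hJc, ← hcs s]
    have := hne s
    field_simp
  -- The normal is `σT' = -X + xT` normalised; its length is `J / σ` by conservation.
  refine ⟨fun s => (σ s / J) • (-X s + (inner ℝ (X s) (T s) : ℝ) • T s),
    fun s => inner ℝ (X s) (T s), J, hJ, hpos, hX, ?_, ?_, hσ, hx, h1, ?_, ?_, ?_, hper, hσper⟩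
  · intro s
    convert hT s using 1
    rw [smul_smul, ← tension_smul_deriv_tangent hT h1 heq, smul_smul]
    have := hne s
    have : J / σ s ^ 2 * (σ s / J) * σ s = 1 := by field_simp
    rw [this, one_smul]
  · intro s
    have h := ((hσ s).div_const J).smul ((hX s).neg.add ((hx s).smul (hT s)))
    refine h.congr_deriv ?_
    simp only [Pi.add_apply, Pi.neg_apply, Pi.smul_apply', smul_add, smul_neg]
    have ht := tension_smul_deriv_tangent hT h1 heq s
    have hn := hne s
    have ht2 : T' s = (σ s)⁻¹ • (-X s + (inner ℝ (X s) (T s) : ℝ) • T s) := by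
      rw [← ht, smul_smul, inv_mul_cancel₀ hn, one_smul]
    rw [ht2]
    match_scalars <;> field_simp <;> ring
  · intro s
    rw [norm_smul, Real.norm_of_nonneg (div_pos (hpos s) hJ).le]
    have hj : 0 < J / σ s := div_pos hJ (hpos s)
    rw [(pow_left_inj₀ (norm_nonneg _) hj.le two_ne_zero).1 (hN2 s)]
    have := hne s
    field_simp
  · intro s
    simp only [real_inner_smul_right, inner_add_right, inner_neg_right]
    rw [real_inner_self_eq_norm_sq, h1, real_inner_comm (X s) (T s)]
    ring
  · intro s
    have : J / σ s * (σ s / J) = 1 := by have := hne s; field_simp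
    simp only [smul_smul, this, one_smul]
    abel

end Construction

/-! ### Uniqueness for the two differential systems. -/

theorem lipschitzOnWith_div_pow_three {k m : ℝ} (hk : 0 ≤ k) (hm : 0 < m) :
    LipschitzOnWith (max 1 (3 * k / m ^ 4)).toNNReal
      (fun p : ℝ × ℝ => (p.2, k / p.1 ^ 3 - 1)) {p | m ≤ p.1} := by
  refine LipschitzOnWith.of_dist_le' fun p hp q hq => ?_
  rw [Prod.dist_eq, Prod.dist_eq]
  simp only [Set.mem_ofPred_eq] at hp hq
  have hp0 : 0 < p.1 := hm.trans_le hp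
  have hq0 : 0 < q.1 := hm.trans_le hq
  refine max_le ?_ ?_
  · refine (le_max_right (dist p.1 q.1) _).trans (le_mul_of_one_le_left ?_ (le_max_left _ _))
    exact le_max_of_le_left dist_nonneg
  · refine le_trans ?_ (mul_le_mul (le_max_right 1 (3 * k / m ^ 4)) (le_max_left _ _)
      dist_nonneg (by positivity))
    rw [Real.dist_eq, Real.dist_eq]
    have h : k / p.1 ^ 3 - 1 - (k / q.1 ^ 3 - 1) =
        -(k * (1 / (p.1 * q.1 ^ 3) + 1 / (p.1 ^ 2 * q.1 ^ 2) + 1 / (p.1 ^ 3 * q.1))) *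
          (p.1 - q.1) := by
      field_simp
      ring
    rw [h, abs_mul]
    refine mul_le_mul_of_nonneg_right ?_ (abs_nonneg _)
    rw [abs_neg, abs_of_nonneg (by positivity)]
    have h1 : 1 / (p.1 * q.1 ^ 3) ≤ 1 / m ^ 4 := by
      refine one_div_le_one_div_of_le (by positivity) ?_
      calc m ^ 4 = m * m ^ 3 := by ring
        _ ≤ _ := by gcongr
    have h2 : 1 / (p.1 ^ 2 * q.1 ^ 2) ≤ 1 / m ^ 4 := by
      refine one_div_le_one_div_of_le (by positivity) ?_
      calc m ^ 4 = m ^ 2 * m ^ 2 := by ring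
        _ ≤ _ := by gcongr
    have h3 : 1 / (p.1 ^ 3 * q.1) ≤ 1 / m ^ 4 := by
      refine one_div_le_one_div_of_le (by positivity) ?_
      calc m ^ 4 = m ^ 3 * m := by ring
        _ ≤ _ := by gcongr
    calc _ ≤ k * (1 / m ^ 4 + 1 / m ^ 4 + 1 / m ^ 4) := by gcongr
      _ = _ := by ring

/-- Uniqueness for the autonomous equation `f'' = k / f ^ 3 - 1` among solutions bounded away
from zero. -/
theorem eq_of_second_order_ode {k m : ℝ} (hk : 0 ≤ k) (hm : 0 < m) {f f' g g' : ℝ → ℝ} {a : ℝ}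
    (hfm : ∀ s, m ≤ f s) (hf : ∀ s, HasDerivAt f (f' s) s)
    (hf' : ∀ s, HasDerivAt f' (k / f s ^ 3 - 1) s)
    (hgm : ∀ s, m ≤ g s) (hg : ∀ s, HasDerivAt g (g' s) s)
    (hg' : ∀ s, HasDerivAt g' (k / g s ^ 3 - 1) s)
    (h0 : f a = g a) (h1 : f' a = g' a) : f = g := by
  have h := ODE_solution_unique_univ (v := fun _ (p : ℝ × ℝ) => (p.2, k / p.1 ^ 3 - 1))
    (s := fun _ => {p | m ≤ p.1}) (f := fun s => (f s, f' s)) (g := fun s => (g s, g' s))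
    (t₀ := a) (fun _ => lipschitzOnWith_div_pow_three hk hm)
    (fun t => ⟨(hf t).prodMk (hf' t), hfm t⟩) (fun t => ⟨(hg t).prodMk (hg' t), hgm t⟩)
    (by simp only [h0, h1])
  funext s
  exact congrArg Prod.fst (congrFun h s)

/-- The system is skew, so the squared distance between two solutions is constant. -/
theorem eq_of_rotation_system {E : Type*} [NormedAddCommGroup E] [InnerProductSpace ℝ E]
    {ω : ℝ → ℝ} {T N T₁ N₁ : ℝ → E} {a : ℝ}
    (hT : ∀ s, HasDerivAt T (ω s • N s) s) (hN : ∀ s, HasDerivAt N (-ω s • T s) s)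
    (hT₁ : ∀ s, HasDerivAt T₁ (ω s • N₁ s) s) (hN₁ : ∀ s, HasDerivAt N₁ (-ω s • T₁ s) s)
    (h0 : T a = T₁ a) (h1 : N a = N₁ a) (s : ℝ) : T s = T₁ s ∧ N s = N₁ s := by
  have hd : ∀ r, HasDerivAt (fun r => inner ℝ (T r - T₁ r) (T r - T₁ r) +
      (inner ℝ (N r - N₁ r) (N r - N₁ r) : ℝ)) 0 r := by
    intro r
    have h := (((hT r).sub (hT₁ r)).inner ℝ ((hT r).sub (hT₁ r))).add
      (((hN r).sub (hN₁ r)).inner ℝ ((hN r).sub (hN₁ r)))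
    refine h.congr_deriv ?_
    simp only [Pi.sub_apply, neg_smul, ← smul_sub, sub_neg_eq_add, neg_add_eq_sub]
    rw [← neg_sub (T r) (T₁ r), smul_neg]
    simp only [inner_neg_left, inner_neg_right, real_inner_smul_left, real_inner_smul_right,
      real_inner_comm (T r - T₁ r) (N r - N₁ r)]
    ring
  have hc := is_const_of_deriv_eq_zero (fun r => (hd r).differentiableAt)
    (fun r => (hd r).deriv) s a
  simp only [h0, h1, sub_self, inner_zero_left, add_zero, real_inner_self_eq_norm_sq] at hc
  have hTs : ‖T s - T₁ s‖ ^ 2 = 0 := by nlinarith [sq_nonneg ‖T s - T₁ s‖, sq_nonneg ‖N s - N₁ s‖]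
  have hNs : ‖N s - N₁ s‖ ^ 2 = 0 := by nlinarith [sq_nonneg ‖T s - T₁ s‖, sq_nonneg ‖N s - N₁ s‖]
  exact ⟨sub_eq_zero.1 (norm_eq_zero.1 (pow_eq_zero_iff two_ne_zero |>.1 hTs)),
    sub_eq_zero.1 (norm_eq_zero.1 (pow_eq_zero_iff two_ne_zero |>.1 hNs))⟩

/-! ### Reflection symmetry about critical points of the tension. -/

namespace StationaryFrame

variable {E : Type*} [NormedAddCommGroup E] [InnerProductSpace ℝ E]
  {X T N : ℝ → E} {σ x : ℝ → ℝ} {J : ℝ}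

theorem exists_le_tension (h : StationaryFrame X T N σ x J) : ∃ m, 0 < m ∧ ∀ s, m ≤ σ s := by
  have hc : Continuous σ := continuous_iff_continuousAt.2 fun s => (h.deriv_tension s).continuousAt
  obtain ⟨m, ⟨s, hs⟩, hm⟩ := (h.periodic_tension.compact_of_continuous one_ne_zero hc).exists_isLeast
    (Set.range_nonempty σ)
  exact ⟨m, hs ▸ h.tension_pos s, fun s => hm ⟨s, rfl⟩⟩

theorem deriv_neg_radial (h : StationaryFrame X T N σ x J) (s : ℝ) :
    HasDerivAt (fun s => -x s) (J ^ 2 / σ s ^ 3 - 1) s :=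
  (h.deriv_radial s).neg.congr_deriv (neg_sub _ _)

/-- The tension is even about each of its critical points. -/
theorem tension_reflect (h : StationaryFrame X T N σ x J) {a : ℝ} (ha : x a = 0) (s : ℝ) :
    σ (2 * a - s) = σ s := by
  obtain ⟨m, hm, hle⟩ := h.exists_le_tension
  refine congrFun (eq_of_second_order_ode (a := a) (sq_nonneg J) hm (fun s => hle (2 * a - s))
    (fun s => (h.deriv_tension (2 * a - s)).comp_const_sub (2 * a) s)
    (fun s => ((h.deriv_neg_radial (2 * a - s)).comp_const_sub (2 * a) s).neg.congr_deriv
      (neg_neg _)) hle h.deriv_tension h.deriv_neg_radial ?_ ?_) s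
  · simp only [two_mul, add_sub_cancel_right]
  · simp only [two_mul, add_sub_cancel_right, ha, neg_zero]

theorem radial_reflect (h : StationaryFrame X T N σ x J) {a : ℝ} (ha : x a = 0) (s : ℝ) :
    x (2 * a - s) = -x s := by
  have h1 := (h.deriv_tension (2 * a - s)).comp_const_sub (2 * a) s
  rw [show (fun s => σ (2 * a - s)) = σ from funext (h.tension_reflect ha)] at h1
  have := h1.unique (h.deriv_tension s)
  linarith

/-- A critical point of the tension at which its second derivative vanishes forces the tension
to be constant. -/
theorem tension_const_of_degenerate (h : StationaryFrame X T N σ x J) {a : ℝ} (ha : x a = 0)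
    (hd : J ^ 2 / σ a ^ 3 = 1) (s : ℝ) : σ s = σ a := by
  obtain ⟨m, hm, hle⟩ := h.exists_le_tension
  exact congrFun (eq_of_second_order_ode (a := a) (g := fun _ => σ a) (g' := fun _ => 0)
    (sq_nonneg J) hm hle h.deriv_tension h.deriv_neg_radial (fun _ => hle a)
    (fun s => hasDerivAt_const s _)
    (fun s => (hasDerivAt_const s _).congr_deriv (by rw [hd, sub_self])) rfl
    (by simp only [ha, neg_zero])) s

/-- The curve is symmetric about each critical point of the tension. -/
theorem curve_reflect (h : StationaryFrame X T N σ x J) {a : ℝ} (ha : x a = 0) (s : ℝ) :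
    (ℝ ∙ T a)ᗮ.reflection (T (2 * a - s)) = -T s ∧
      (ℝ ∙ T a)ᗮ.reflection (X (2 * a - s)) = X s := by
  set R := (ℝ ∙ T a)ᗮ.reflection with hR
  have hd : ∀ {f : ℝ → E} {v : E} {r : ℝ}, HasDerivAt f v (2 * a - r) →
      HasDerivAt (fun r => R (f (2 * a - r))) (-R v) r := by
    intro f v r hf
    have := R.hasFDerivAt.comp_hasDerivAt r (hf.comp_const_sub (2 * a) r)
    exact this.congr_deriv (map_neg R v)
  have key := eq_of_rotation_system (ω := fun s => J / σ s ^ 2) (a := a)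
    (T₁ := fun s => -R (T (2 * a - s))) (N₁ := fun s => R (N (2 * a - s)))
    h.deriv_tangent h.deriv_normal
    (fun r => (hd (h.deriv_tangent (2 * a - r))).neg.congr_deriv (by
      rw [neg_neg, map_smul, h.tension_reflect ha]))
    (fun r => (hd (h.deriv_normal (2 * a - r))).congr_deriv (by
      rw [map_smul, h.tension_reflect ha, neg_smul, neg_smul, smul_neg]))
    (by simp only [two_mul, add_sub_cancel_right]
        rw [hR, Submodule.reflection_orthogonalComplement_singleton_eq_neg, neg_neg])
    (by simp only [two_mul, add_sub_cancel_right]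
        rw [hR, Submodule.reflection_mem_subspace_eq_self]
        exact Submodule.mem_orthogonal_singleton_iff_inner_right.2 (h.orthogonal a)) s
  have hT : R (T (2 * a - s)) = -T s := by rw [key.1, neg_neg]
  refine ⟨hT, ?_⟩
  rw [h.curve_eq (2 * a - s), map_sub, map_smul, map_smul, hT, ← key.2, h.radial_reflect ha,
    h.tension_reflect ha, neg_smul, smul_neg, neg_neg, ← h.curve_eq]

theorem periodic_tangent (h : StationaryFrame X T N σ x J) : Function.Periodic T 1 := by
  intro s
  have h1 := (h.deriv_curve (s + 1)).comp_add_const s 1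
  rw [show (fun s => X (s + 1)) = X from funext h.periodic_curve] at h1
  exact h1.unique (h.deriv_curve s)

theorem periodic_radial (h : StationaryFrame X T N σ x J) : Function.Periodic x 1 := by
  intro s
  have h1 := (h.deriv_tension (s + 1)).comp_add_const s 1
  rw [show (fun s => σ (s + 1)) = σ from funext h.periodic_tension] at h1
  exact neg_injective (h1.unique (h.deriv_tension s))

end StationaryFrame

/-! ### Signs and isolation of zeros. -/

section Zeros

variable {x : ℝ → ℝ} {a b c d t : ℝ}

theorem mul_deriv_nonpos_of_ne_zero_left (hc : Continuous x) (hb : x b = 0)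
    (hd : HasDerivAt x d b) (hne : ∀ s ∈ Set.Ioo a b, x s ≠ 0) (ht : t ∈ Set.Ioo a b) :
    x t * d ≤ 0 := by
  have hpos : ∀ s ∈ Set.Ioo t b, 0 < x t * x s := by
    intro s hs
    by_contra! hle
    have h0 : (0 : ℝ) ∈ (fun s => x t * x s) '' Set.Icc t s :=
      intermediate_value_Icc' hs.1.le (by fun_prop) ⟨hle, mul_self_nonneg _⟩
    obtain ⟨r, hr, hr0⟩ := h0
    rcases mul_eq_zero.1 hr0 with h | h
    · exact hne t ht h
    · exact hne r ⟨ht.1.trans_le hr.1, hr.2.trans_lt hs.2⟩ h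
  have hs := (hasDerivWithinAt_iff_tendsto_slope' (Set.self_notMem_Iio)).1
    ((hd.const_mul (x t)).hasDerivWithinAt (s := Set.Iio b))
  refine le_of_tendsto hs ?_
  filter_upwards [Ioo_mem_nhdsLT ht.2] with s hs
  rw [slope_def_field, hb, mul_zero, sub_zero]
  exact div_nonpos_of_nonneg_of_nonpos (hpos s hs).le (sub_nonpos.2 hs.2.le)

theorem mul_deriv_nonneg_of_ne_zero_right (hc : Continuous x) (hb : x b = 0)
    (hd : HasDerivAt x d b) (hne : ∀ s ∈ Set.Ioo b c, x s ≠ 0) (ht : t ∈ Set.Ioo b c) :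
    0 ≤ x t * d := by
  have hd' : HasDerivAt (fun s => x (-s)) (-d) (-b) := by
    have h1 : HasDerivAt x d (0 - -b) := by rwa [zero_sub, neg_neg]
    simpa only [zero_sub] using h1.comp_const_sub 0 (-b)
  have := mul_deriv_nonpos_of_ne_zero_left (x := fun s => x (-s)) (a := -c) (b := -b) (t := -t)
    (hc.comp continuous_neg) (by simpa using hb) hd'
    (fun s hs => hne (-s) ⟨by linarith [hs.2], by linarith [hs.1]⟩)
    ⟨neg_lt_neg ht.2, neg_lt_neg ht.1⟩
  simp only [neg_neg, mul_neg] at this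
  linarith

/-- The non-zero derivative isolates the zero at `a`, so the remaining zeros form a compact set with
a least element. -/
theorem exists_first_zero (hc : Continuous x) (hd : HasDerivAt x d a) (hd0 : d ≠ 0)
    (hab : a < b) (hb : x b = 0) :
    ∃ r ∈ Set.Ioc a b, x r = 0 ∧ ∀ s ∈ Set.Ioo a r, x s ≠ 0 := by
  obtain ⟨u, hu, hun⟩ : ∃ u ∈ Set.Ioi a, Set.Ioo a u ⊆ {s | x s ≠ 0} :=
    (mem_nhdsGT_iff_exists_Ioo_subset).1
      (nhdsWithin_mono a (fun s (hs : a < s) => ne_of_gt hs) (hd.eventually_ne (c := 0) hd0))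
  have hub : u ≤ b := by
    by_contra! h
    exact hun ⟨hab, h⟩ hb
  obtain ⟨r, ⟨hr, hr0⟩, hmin⟩ := ((isCompact_Icc (a := u) (b := b)).inter_right
    (isClosed_eq hc continuous_const : IsClosed {s | x s = 0})).exists_isLeast
    ⟨b, ⟨hub, le_rfl⟩, hb⟩
  refine ⟨r, ⟨lt_of_lt_of_le hu hr.1, hr.2⟩, hr0, fun s hs h0 => ?_⟩
  rcases lt_or_ge s u with h | h
  · exact hun ⟨hs.1, h⟩ h0
  · exact absurd (hmin ⟨⟨h, hs.2.le.trans hr.2⟩, h0⟩) (not_le.2 hs.2)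

theorem exists_last_zero (hc : Continuous x) (hd : HasDerivAt x d c) (hd0 : d ≠ 0)
    (hbc : b < c) (hb : x b = 0) :
    ∃ r ∈ Set.Ico b c, x r = 0 ∧ ∀ s ∈ Set.Ioo r c, x s ≠ 0 := by
  have hd' : HasDerivAt (fun s => x (-s)) (-d) (-c) := by
    have h1 : HasDerivAt x d (0 - -c) := by rwa [zero_sub, neg_neg]
    simpa only [zero_sub] using h1.comp_const_sub 0 (-c)
  obtain ⟨r, hr, hr0, hne⟩ := exists_first_zero (x := fun s => x (-s)) (b := -b)
    (hc.comp continuous_neg) hd' (neg_ne_zero.2 hd0) (neg_lt_neg hbc) (by simpa using hb)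
  refine ⟨-r, ⟨by linarith [hr.2], by linarith [hr.1]⟩, hr0, fun s hs => ?_⟩
  have := hne (-s) ⟨by linarith [hs.2], by linarith [hs.1]⟩
  rwa [neg_neg] at this

end Zeros

/-! ### Sturm comparison in the tangent angle. -/

section Sturm

variable {σ x α β : ℝ → ℝ} {J a c : ℝ}

/-- With `β = sin θ`, this is `J` times the `θ`-Wronskian of `x` and `sin θ`, where `x_θθ + (1 +
2σ³/J²) x = 0`. -/
theorem hasDerivAt_first_wronskian (hσ : ∀ s, 0 < σ s) (dσ : ∀ s, HasDerivAt σ (-x s) s)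
    (dx : ∀ s, HasDerivAt x (1 - J ^ 2 / σ s ^ 3) s)
    (dα : ∀ s, HasDerivAt α (-(J * β s / σ s ^ 2)) s)
    (dβ : ∀ s, HasDerivAt β (J * α s / σ s ^ 2) s) (s : ℝ) :
    HasDerivAt (fun s => (σ s ^ 2 - J ^ 2 / σ s) * β s - J * (x s * α s))
      (-(2 * σ s * x s * β s)) s := by
  have hn := (hσ s).ne'
  refine (((((dσ s).pow 2).sub ((hasDerivAt_const s (J ^ 2)).div (dσ s) hn)).mul (dβ s)).sub
    (((dx s).mul (dα s)).const_mul J)).congr_deriv ?_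
  simp only [Pi.sub_apply, Pi.pow_apply, Pi.div_apply]
  field_simp
  ring

/-- With `v = J x / σ`, this is the `θ`-Wronskian of `v` and `αβ = sin 2θ / 2`, where `v_θθ + (4 -
σ³/J²) v = 0`. -/
theorem hasDerivAt_second_wronskian (hσ : ∀ s, 0 < σ s) (dσ : ∀ s, HasDerivAt σ (-x s) s)
    (dx : ∀ s, HasDerivAt x (1 - J ^ 2 / σ s ^ 3) s)
    (dα : ∀ s, HasDerivAt α (-(J * β s / σ s ^ 2)) s)
    (dβ : ∀ s, HasDerivAt β (J * α s / σ s ^ 2) s) (s : ℝ) :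
    HasDerivAt (fun s => (σ s - J ^ 2 / σ s ^ 2 + x s ^ 2) * (α s * β s) -
      J * (x s * (α s ^ 2 - β s ^ 2) / σ s)) (x s * α s * β s) s := by
  have hn := (hσ s).ne'
  refine (((((dσ s).sub ((hasDerivAt_const s (J ^ 2)).div ((dσ s).pow 2) (pow_ne_zero 2 hn))).add
    ((dx s).pow 2)).mul ((dα s).mul (dβ s))).sub
    ((((dx s).mul (((dα s).pow 2).sub ((dβ s).pow 2))).div (dσ s) hn).const_mul J)).congr_deriv ?_
  simp only [Pi.sub_apply, Pi.pow_apply, Pi.div_apply, Pi.mul_apply, Pi.add_apply]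
  field_simp
  ring

/-- Sturm comparison: on an arc turning by a half turn between two critical points of the
tension, a nondegenerate tension cannot exist. Here `α`, `β` are the cosine and sine of the
turning angle. -/
theorem exists_degenerate_of_half_turn (hac : a < c) (hJ : 0 < J) (hσ : ∀ s, 0 < σ s)
    (dσ : ∀ s, HasDerivAt σ (-x s) s)
    (dx : ∀ s, HasDerivAt x (1 - J ^ 2 / σ s ^ 3) s)
    (dα : ∀ s, HasDerivAt α (-(J * β s / σ s ^ 2)) s)
    (dβ : ∀ s, HasDerivAt β (J * α s / σ s ^ 2) s)
    (hf : ∀ s ∈ Set.Ioo a c, 0 < x s * α s + J / σ s * β s)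
    (hβa : β a = 0) (hβc : β c = 0) (hxa : x a = 0) (hxc : x c = 0) :
    ∃ s, x s = 0 ∧ J ^ 2 / σ s ^ 3 = 1 := by
  by_contra! hnd
  have hx : Continuous x := continuous_iff_continuousAt.2 fun s => (dx s).continuousAt
  have hα : Continuous α := continuous_iff_continuousAt.2 fun s => (dα s).continuousAt
  have hβ : Continuous β := continuous_iff_continuousAt.2 fun s => (dβ s).continuousAt
  have hσc : Continuous σ := continuous_iff_continuousAt.2 fun s => (dσ s).continuousAt
  have hanti : StrictAntiOn (fun s => σ s * α s) (Set.Icc a c) := by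
    refine strictAntiOn_of_deriv_neg (convex_Icc a c) (hσc.mul hα).continuousOn fun s hs => ?_
    rw [interior_Icc] at hs
    rw [show deriv (fun s => σ s * α s) s = _ from ((dσ s).mul (dα s)).deriv]
    have h := hf s hs
    have hn := (hσ s).ne'
    have : -x s * α s + σ s * -(J * β s / σ s ^ 2) = -(x s * α s + J / σ s * β s) := by
      field_simp
      ring
    rw [this]
    linarith
  -- `p` is the quarter turn: `α` changes sign only there, since `σα` is strictly decreasing.
  obtain ⟨p, hp, hp0⟩ := exists_hasDerivAt_eq_zero hac hβ.continuousOn (hβa.trans hβc.symm)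
    fun s _ => dβ s
  have hαp : α p = 0 := by
    simpa [hJ.ne', (hσ p).ne'] using hp0
  have hpI := Set.Ioo_subset_Icc_self hp
  have hαpos : ∀ s ∈ Set.Ico a p, 0 < α s := by
    intro s hs
    have := hanti ⟨hs.1, hs.2.le.trans hpI.2⟩ hpI hs.2
    simp only [hαp, mul_zero] at this
    exact pos_of_mul_pos_right this (hσ s).le
  have hαneg : ∀ s ∈ Set.Ioc p c, α s < 0 := by
    intro s hs
    have := hanti hpI ⟨hpI.1.trans hs.1.le, hs.2⟩ hs.1
    simp only [hαp, mul_zero] at this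
    exact neg_of_mul_neg_right this (hσ s).le
  have hβmono : StrictMonoOn β (Set.Icc a p) := by
    refine strictMonoOn_of_deriv_pos (convex_Icc a p) hβ.continuousOn fun s hs => ?_
    rw [interior_Icc] at hs
    rw [(dβ s).deriv]
    exact div_pos (mul_pos hJ (hαpos s (Set.Ioo_subset_Ico_self hs))) (pow_pos (hσ s) 2)
  have hβanti : StrictAntiOn β (Set.Icc p c) := by
    refine strictAntiOn_of_deriv_neg (convex_Icc p c) hβ.continuousOn fun s hs => ?_
    rw [interior_Icc] at hs
    rw [(dβ s).deriv]
    exact div_neg_of_neg_of_pos (mul_neg_of_pos_of_neg hJ (hαneg s (Set.Ioo_subset_Ioc_self hs)))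
      (pow_pos (hσ s) 2)
  have hβpos : ∀ s ∈ Set.Ioo a c, 0 < β s := by
    intro s hs
    rcases le_or_gt s p with h | h
    · rw [← hβa]
      exact hβmono ⟨le_rfl, hpI.1⟩ ⟨hs.1.le, h⟩ hs.1
    · rw [← hβc]
      exact hβanti ⟨h.le, hs.2.le⟩ ⟨hpI.2, le_rfl⟩ hs.2
  -- Rolle for the first Wronskian, which vanishes at both ends.
  obtain ⟨q, hq, hq0⟩ := exists_hasDerivAt_eq_zero
    (f := fun s => (σ s ^ 2 - J ^ 2 / σ s) * β s - J * (x s * α s)) hac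
    (fun s _ => (hasDerivAt_first_wronskian hσ dσ dx dα dβ s).continuousAt.continuousWithinAt)
    (by simp only [hβa, hβc, hxa, hxc, mul_zero, zero_mul])
    fun s _ => hasDerivAt_first_wronskian hσ dσ dx dα dβ s
  have hxq : x q = 0 := by
    simpa [(hσ q).ne', (hβpos q hq).ne'] using hq0
  have dH := hasDerivAt_second_wronskian hσ dσ dx dα dβ
  have hnd' : ∀ s, x s = 0 → 1 - J ^ 2 / σ s ^ 3 ≠ 0 := fun s hs h =>
    hnd s hs (sub_eq_zero.1 h).symm
  have hval : ∀ s, x s = 0 → (σ s - J ^ 2 / σ s ^ 2 + x s ^ 2) * (α s * β s) -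
      J * (x s * (α s ^ 2 - β s ^ 2) / σ s) =
      (1 - J ^ 2 / σ s ^ 3) * (σ s * (α s * β s)) := by
    intro s hs
    have := (hσ s).ne'
    rw [hs]
    field_simp
    ring
  -- Work on the quarter turn containing `q`, with `b` the zero of `x` nearest its end of the arc.
  -- If `q ≤ p`, the second Wronskian vanishes at `a` and its derivative `xαβ` has the sign of `x`,
  -- so its value at `b` does too; but that value is `x'(b)σαβ`, and `x'(b)` cannot have that sign.
  -- The other case is the mirror image at `c`.
  rcases le_or_gt q p with hqp | hpq
  · obtain ⟨b, hb, hxb, hne⟩ := exists_first_zero hx (dx a) (hnd' a hxa) hq.1 hxq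
    obtain ⟨t, ht, hmv⟩ := exists_hasDerivAt_eq_slope _ _ hb.1
      (fun s _ => (dH s).continuousAt.continuousWithinAt) fun s _ => dH s
    rw [hval b hxb, hval a hxa, hβa, mul_zero, mul_zero, mul_zero, sub_zero,
      eq_div_iff (sub_pos.2 hb.1).ne'] at hmv
    have h1 := mul_deriv_nonpos_of_ne_zero_left hx hxb (dx b) hne ht
    have hbp : b ≤ p := hb.2.trans hqp
    have hαb : 0 ≤ α b := by
      rcases hbp.lt_or_eq with h | h
      · exact (hαpos b ⟨hb.1.le, h⟩).le
      · rw [h, hαp]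
    have hβb := hβpos b ⟨hb.1, hbp.trans_lt hp.2⟩
    have hβt := hβpos t ⟨ht.1, ht.2.trans (hbp.trans_lt hp.2)⟩
    have hαt := hαpos t ⟨ht.1.le, ht.2.trans_le hbp⟩
    have hxt := hne t ht
    have h2 : 0 < x t ^ 2 * (α t * β t) * (b - a) := by
      have := sub_pos.2 hb.1
      positivity
    have h3 : x t * (1 - J ^ 2 / σ b ^ 3) * (σ b * (α b * β b)) ≤ 0 :=
      mul_nonpos_of_nonpos_of_nonneg h1 (by have := hσ b; positivity)
    have h4 : x t ^ 2 * (α t * β t) * (b - a) =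
        x t * (1 - J ^ 2 / σ b ^ 3) * (σ b * (α b * β b)) := by
      linear_combination x t * hmv
    linarith
  · obtain ⟨b, hb, hxb, hne⟩ := exists_last_zero hx (dx c) (hnd' c hxc) hq.2 hxq
    obtain ⟨t, ht, hmv⟩ := exists_hasDerivAt_eq_slope _ _ hb.2
      (fun s _ => (dH s).continuousAt.continuousWithinAt) fun s _ => dH s
    rw [hval b hxb, hval c hxc, hβc, mul_zero, mul_zero, mul_zero, zero_sub,
      eq_div_iff (sub_pos.2 hb.2).ne'] at hmv
    have h1 := mul_deriv_nonneg_of_ne_zero_right hx hxb (dx b) hne ht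
    have hpb : p < b := hpq.trans_le hb.1
    have hαb := hαneg b ⟨hpb, hb.2.le⟩
    have hβb := hβpos b ⟨hp.1.trans hpb, hb.2⟩
    have hβt := hβpos t ⟨hp.1.trans (hpb.trans ht.1), ht.2⟩
    have hαt := hαneg t ⟨hpb.trans ht.1, ht.2.le⟩
    have hxt := hne t ht
    have h2 : 0 < x t ^ 2 * (-α t * β t) * (c - b) := by
      have := sub_pos.2 hb.2
      have := neg_pos.2 hαt
      positivity
    have h3 : 0 ≤ x t * (1 - J ^ 2 / σ b ^ 3) * (σ b * (-α b * β b)) :=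
      mul_nonneg h1 (by have := hσ b; have := neg_pos.2 hαb; positivity)
    have h4 : -(x t ^ 2 * (-α t * β t) * (c - b)) =
        x t * (1 - J ^ 2 / σ b ^ 3) * (σ b * (-α b * β b)) := by
      linear_combination x t * hmv
    linarith

end Sturm

/-! ### Simple curves: degeneracy, then the circle. -/

namespace StationaryFrame

variable {E : Type*} [NormedAddCommGroup E] [InnerProductSpace ℝ E]
  {X T N : ℝ → E} {σ x : ℝ → ℝ} {J : ℝ}

/-- A simple stationary curve has constant tension. -/
theorem exists_degenerate (h : StationaryFrame X T N σ x J)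
    (hinj : ∀ s t, X s = X t → ∃ n : ℤ, s - t = n) :
    ∃ s, x s = 0 ∧ J ^ 2 / σ s ^ 3 = 1 := by
  have hσc : Continuous σ := continuous_iff_continuousAt.2 fun s => (h.deriv_tension s).continuousAt
  have hXc : Continuous X := continuous_iff_continuousAt.2 fun s => (h.deriv_curve s).continuousAt
  obtain ⟨a, -, ha⟩ := exists_hasDerivAt_eq_zero one_pos hσc.continuousOn
    (by simpa using (h.periodic_tension 0).symm) fun s _ => h.deriv_tension s
  replace ha : x a = 0 := neg_eq_zero.1 ha
  set R := (ℝ ∙ T a)ᗮ.reflection with hR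
  have hac : a < a + 1 / 2 := by linarith
  have hshift : 2 * a - (a + 1 / 2) = a + 1 / 2 - 1 := by ring
  have hxc : x (a + 1 / 2) = 0 := by
    have h1 := h.radial_reflect ha (a + 1 / 2)
    rw [hshift, h.periodic_radial.sub_eq] at h1
    linarith
  have hXa : (inner ℝ (X a) (T a) : ℝ) = 0 := by
    rw [h.curve_eq, ha, zero_smul, zero_sub, inner_neg_left, real_inner_smul_left,
      real_inner_comm, h.orthogonal, mul_zero, neg_zero]
  -- A point on the mirror equals its reflection, so `X (2 * a - s) = X s`; but the parameters
  -- differ by less than a period.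
  have hne : ∀ s ∈ Set.Ioo a (a + 1 / 2), (inner ℝ (X s) (T a) : ℝ) ≠ 0 := by
    intro s hs h0
    have h1 : R (X s) = X s := Submodule.reflection_mem_subspace_eq_self
      (Submodule.mem_orthogonal_singleton_iff_inner_right.2 (by rw [real_inner_comm, h0]))
    have h2 : X (2 * a - s) = X s := R.injective ((h.curve_reflect ha s).2.trans h1.symm)
    obtain ⟨n, hn⟩ := hinj _ _ h2
    have h3 : (n : ℝ) < 0 := by rw [← hn]; linarith [hs.1]
    have h4 : (-1 : ℝ) < n := by rw [← hn]; linarith [hs.2]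
    have h5 : n < 0 := by exact_mod_cast h3
    have h6 : -1 < n := by exact_mod_cast h4
    lia
  have hd : ∀ {f : ℝ → E} {v : E} {s : ℝ}, HasDerivAt f v s →
      HasDerivAt (fun s => (inner ℝ (f s) (T a) : ℝ)) (inner ℝ v (T a)) s := fun hf => by
    simpa using hf.inner ℝ (hasDerivAt_const _ (T a))
  have hpos : ∀ s ∈ Set.Ioo a (a + 1 / 2), 0 < (inner ℝ (X s) (T a) : ℝ) := by
    intro s hs
    have h1 := mul_deriv_nonneg_of_ne_zero_right (by fun_prop) hXa (hd (h.deriv_curve a)) hne hs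
    rw [real_inner_self_eq_norm_sq, h.norm_tangent, one_pow, mul_one] at h1
    exact lt_of_le_of_ne h1 (hne s hs).symm
  have hTc : T (a + 1 / 2) ∈ (ℝ ∙ T a) := by
    have h1 := (h.curve_reflect ha (a + 1 / 2)).1
    rw [hshift, h.periodic_tangent.sub_eq, Submodule.reflection_orthogonal_apply] at h1
    exact (Submodule.reflection_eq_self_iff _).1 (neg_injective h1)
  have hNc : (inner ℝ (N (a + 1 / 2)) (T a) : ℝ) = 0 := by
    obtain ⟨μ, hμ⟩ := Submodule.mem_span_singleton.1 hTc
    have h1 := h.orthogonal (a + 1 / 2)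
    rw [← hμ, real_inner_smul_left, real_inner_comm] at h1
    refine (mul_eq_zero.1 h1).resolve_left fun h0 => ?_
    have h2 := h.norm_tangent (a + 1 / 2)
    rw [← hμ, h0, zero_smul, norm_zero] at h2
    exact zero_ne_one h2
  refine exists_degenerate_of_half_turn (α := fun s => inner ℝ (T s) (T a))
    (β := fun s => -inner ℝ (N s) (T a)) hac h.J_pos h.tension_pos h.deriv_tension h.deriv_radial
    (fun s => (hd (h.deriv_tangent s)).congr_deriv ?_)
    (fun s => (hd (h.deriv_normal s)).neg.congr_deriv ?_) (fun s hs => ?_) ?_ ?_ ha hxc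
  · rw [real_inner_smul_left]
    ring
  · rw [real_inner_smul_left]
    ring
  · have h1 := hpos s hs
    rw [h.curve_eq, inner_sub_left, real_inner_smul_left, real_inner_smul_left] at h1
    linarith
  · rw [real_inner_comm, h.orthogonal, neg_zero]
  · rw [hNc, neg_zero]

/-- A simple stationary curve is a round circle of radius `1 / (2 * π)` about the origin. -/
theorem eq_circle (h : StationaryFrame X T N σ x J)
    (hinj : ∀ s t, X s = X t → ∃ n : ℤ, s - t = n) :
    (∀ s, σ s = 1 / (4 * π ^ 2)) ∧ ∀ s,
      X s = (1 / (2 * π)) • (cos (2 * π * s) • (-N 0) + sin (2 * π * s) • T 0) := by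
  obtain ⟨a, ha, hdeg⟩ := h.exists_degenerate hinj
  have hσ := h.tension_const_of_degenerate ha hdeg
  obtain ⟨κ, hκ⟩ : ∃ κ, κ = σ a := ⟨_, rfl⟩
  simp only [← hκ] at hσ hdeg
  have hκ0 : 0 < κ := hκ ▸ h.tension_pos a
  have hx : ∀ s, x s = 0 := by
    intro s
    have h1 := h.deriv_tension s
    rw [show σ = fun _ => κ from funext hσ] at h1
    exact neg_eq_zero.1 (h1.unique (hasDerivAt_const s κ))
  obtain ⟨ω, hω⟩ : ∃ ω, ω = J / κ ^ 2 := ⟨_, rfl⟩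
  have hω0 : 0 < ω := hω ▸ div_pos h.J_pos (pow_pos hκ0 2)
  have hωκ : κ = 1 / ω ^ 2 := by
    have := h.J_pos.ne'
    rw [hω]
    field_simp at hdeg ⊢
    linarith
  have hlin : ∀ s, HasDerivAt (fun s : ℝ => ω * s) ω s := fun s => by
    simpa using (hasDerivAt_id s).const_mul ω
  have hrot := eq_of_rotation_system (a := 0) (ω := fun _ => ω)
    (T₁ := fun s => cos (ω * s) • T 0 + sin (ω * s) • N 0)
    (N₁ := fun s => cos (ω * s) • N 0 - sin (ω * s) • T 0)
    (fun s => (h.deriv_tangent s).congr_deriv (by rw [hσ, hω]))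
    (fun s => (h.deriv_normal s).congr_deriv (by rw [hσ, hω]))
    (fun s => (((hlin s).cos.smul_const (T 0)).add
      ((hlin s).sin.smul_const (N 0))).congr_deriv (by module))
    (fun s => (((hlin s).cos.smul_const (N 0)).sub
      ((hlin s).sin.smul_const (T 0))).congr_deriv (by module))
    (by simp) (by simp)
  have hX : ∀ s, X s = (1 / ω) • (cos (ω * s) • (-N 0) + sin (ω * s) • T 0) := by
    intro s
    have hJ : J / κ = 1 / ω := by
      have := h.J_pos.ne'
      rw [hω]
      field_simp at hdeg ⊢
      linarith
    rw [h.curve_eq, hx, hσ, (hrot s).2, hJ]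
    module
  have hcos : cos ω = 1 := by
    have h1 := (hrot 1).1
    have h2 := h.periodic_tangent 0
    rw [zero_add] at h2
    rw [h2, mul_one] at h1
    have h3 := congrArg (fun v => (inner ℝ v (T 0) : ℝ)) h1
    simp only [inner_add_left, real_inner_smul_left, real_inner_self_eq_norm_sq,
      h.norm_tangent, real_inner_comm (T 0) (N 0), h.orthogonal] at h3
    linarith
  obtain ⟨n, hn⟩ := (cos_eq_one_iff ω).1 hcos
  -- `2π/ω` is the time of one turn, so simplicity makes it an integer, while closedness gave `ω =
  -- 2πn`; hence `nm = 1`.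
  obtain ⟨m, hm⟩ : ∃ m : ℤ, 2 * π / ω - 0 = m := by
    refine hinj _ _ ?_
    rw [hX, hX, mul_div_cancel₀ _ hω0.ne', cos_two_pi, sin_two_pi, mul_zero, cos_zero, sin_zero]
  have hnm : n * m = 1 := by
    have : (n : ℝ) * m = 1 := by
      rw [← hm, sub_zero, mul_div_assoc', hn, div_self hω0.ne']
    exact_mod_cast this
  have hnpos : 0 < n := by
    have : (0 : ℝ) < n := by
      rw [← hn] at hω0
      exact pos_of_mul_pos_left hω0 (by positivity)
    exact_mod_cast this
  have hn1 : n = 1 := Int.eq_one_of_mul_eq_one_right hnpos.le hnm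
  have hω2 : ω = 2 * π := by rw [← hn, hn1, Int.cast_one, one_mul]
  refine ⟨fun s => ?_, fun s => ?_⟩
  · rw [hσ, hωκ, hω2]
    ring
  · rw [hX, hω2]

end StationaryFrame

theorem circleLift_periodic {E : Type*} (f : UnitAddCircle → E) :
    Function.Periodic (circleLift f) 1 := fun s => by
  unfold circleLift
  rw [AddCircle.coe_add_period]

theorem proposition3p5 (d : ℕ) (hd : 2 ≤ d)
    (ξ : UnitAddCircle → EuclideanSpace ℝ (Fin d)) (σ : UnitAddCircle → ℝ)
    (hξ : IsC2OnCircle ξ)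
    (hstat : IsStationarySolution ξ σ)
    (hsimple : Function.Injective ξ)
    (hσ : (27 / 32 : ℝ) * (1 / (4 * π ^ 2)) ≤ ∫ s in (0 : ℝ)..1, circleLift σ s) :
    (∀ s : UnitAddCircle, σ s = 1 / (4 * π ^ 2)) ∧ IsRoundCircle ξ 0 (1 / (2 * π)) := by
  have hξ' : ContDiff ℝ (1 + 1) (circleLift ξ) := hξ
  have hdiff : ContDiff ℝ 1 (deriv (circleLift ξ)) := (contDiff_succ_iff_deriv.1 hξ').2.2
  have hint : 0 < ∫ s in (0 : ℝ)..1, circleLift σ s := lt_of_lt_of_le (by positivity) hσ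
  obtain ⟨N, x, J, h⟩ := exists_stationaryFrame
    (fun s => (hξ.differentiable two_ne_zero s).hasDerivAt)
    (fun s => (hdiff.differentiable one_ne_zero s).hasDerivAt)
    (hdiff.continuous_deriv le_rfl) hstat.unit_speed hstat.equation
    (circleLift_periodic ξ) (circleLift_periodic σ) hint
  obtain ⟨h1, h2⟩ := h.eq_circle fun s t hst => by
    have h3 : ((s - t : ℝ) : UnitAddCircle) = 0 := by
      rw [AddCircle.coe_sub, sub_eq_zero]
      exact hsimple hst
    obtain ⟨n, hn⟩ := (AddCircle.coe_eq_zero_iff 1).1 h3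
    exact ⟨n, by rw [← hn, zsmul_eq_mul, mul_one]⟩
  refine ⟨fun s => ?_, -N 0, deriv (circleLift ξ) 0, ?_, h.norm_tangent 0, ?_, fun t => ?_⟩
  · induction s using QuotientAddGroup.induction_on with
    | H z => exact h1 z
  · rw [norm_neg, h.norm_normal]
  · rw [inner_neg_left, real_inner_comm, h.orthogonal, neg_zero]
  · rw [zero_add]
    exact h2 t
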